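/- **Theorem 1.3.** Let $n\ge 3$, $m\ge 1$, and let $\mathbb{R}^n$, with coordinates $x=(x_1,\dots,x_n)$, carry the pseudo-Euclidean metric $g=\sum_i\varepsilon_i\,dx_i^2$, $\varepsilon_i\in\{1,-1\}$. Let $(F^m,g_F)$ be a non-empty $m$-dimensional semi-Riemannian Einstein manifold with constant Ricci curvature $\lambda_F\in\mathbb{R}$, i.e. $\mathrm{Ric}_{g_F}=\lambda_F\,g_F$. Let $\alpha=(\alpha_1,\dots,\alpha_n)\in\mathbb{R}^n$ be a nonzero vector, put $\xi=\sum_{i=1}^n\alpha_ix_i$, and let $\varphi,f,h:\mathbb{R}\to\mathbb{R}$ be smooth functions of the variable $\xi$ with $f>0$ and $\varphi$ nowhere zero; through $\xi$ they are also regarded as functions on $\mathbb{R}^n$. On $M=\mathbb{R}^n\times F$ consider the warped product metric $$\widetilde g=\frac{1}{\varphi^2}\,g+f^2g_F ,$$ and regard $h$ as a function on $M$ that does not depend on the point of $F$. Let $\rho\in\mathbb{R}$. We say that $\widetilde g$ is a gradient Ricci soliton with potential function $h$ and constant $\rho$ if $\mathrm{Ric}_{\widetilde g}+\mathrm{Hess}_{\widetilde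 g}(h)=\rho\,\widetilde g$ on $M$. Primes denote derivatives with respect to $\xi$. (i) If $\sum_{i=1}^n\varepsilon_i\alpha_i^2=\pm1$, then $\widetilde g$ is a gradient Ricci soliton with potential function $h$ and constant $\rho$ if and only if, for all $\xi\in\mathbb{R}$, $$\begin{cases}(n-2)f\varphi''+f\varphi h''-m\varphi f''-2m\varphi'f'+2f\varphi'h'=0,\\[4pt] \displaystyle\sum_{k=1}^n\varepsilon_k\alpha_k^2\big[f\varphi\varphi''-(n-1)f\varphi'^2+m\varphi\varphi'f'-f\varphi\varphi'h'\big]=\rho f,\\[4pt] \displaystyle\sum_{k=1}^n\varepsilon_k\alpha_k^2\big[-f\varphi^2f''+(n-2)f\varphi\varphi'f'-(m-1)\varphi^2f'^2+f\varphi^2f'h'\big]=\rho f^2-\lambda_F.\end{cases}$$ (ii) If $\sum_{i=1}^n\varepsilon_i\alpha_i^2=0$, then $\widetilde g$ is a gradient Ricci soliton with potential function $h$ and constant $\rho$ if and only if $$(n-2)f\varphi''+f\varphi h''-m\varphi f''-2m\varphi'f'+2f\varphi'h'=0\quad\text{for all }\xi\in\mathbb{R},\qquad\text{and}\qquad\rho=\lambda_F=0.$$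 -/

import Mathlib

set_option maxSynthPendingDepth 3

open scoped Manifold ContDiff

noncomputable section

namespace SemiRiemannian

/-! ### Tensor calculus on a coordinate domain

`E` is a finite-dimensional real vector space, and `G` is a field of bilinear forms, given near a
point `x` of `E`. -/

section Coordinates

variable {E : Type*} [NormedAddCommGroup E] [NormedSpace ℝ E]

/-- Christoffel symbols of the first kind:
`Γ(u, v, w) = (∂_u G(v, w) + ∂_v G(u, w) - ∂_w G(u, v)) / 2`. -/
def christoffelFirst (G : E → E →L[ℝ] E →L[ℝ] ℝ) (x : E) : E →L[ℝ] E →L[ℝ] E →L[ℝ] ℝ :=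
  (1 / 2 : ℝ) • (fderiv ℝ G x + (fderiv ℝ G x).flip
    - ((ContinuousLinearMap.flipₗᵢ ℝ E E ℝ).toContinuousLinearEquiv :
        (E →L[ℝ] E →L[ℝ] ℝ) →L[ℝ] E →L[ℝ] E →L[ℝ] ℝ) ∘L (fderiv ℝ G x).flip)

theorem christoffelFirst_apply (G : E → E →L[ℝ] E →L[ℝ] ℝ) (x u v w : E) :
    christoffelFirst G x u v w =
      (fderiv ℝ G x u v w + fderiv ℝ G x v u w - fderiv ℝ G x w u v) / 2 := by
  simp [christoffelFirst]
  ring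

/-- Christoffel symbols of the second kind: `Γ(u, v)` is the vector with
`G(Γ(u, v), w) = Γ(u, v, w)` for all `w`, obtained by inverting `G x : E → E*`. -/
def christoffel (G : E → E →L[ℝ] E →L[ℝ] ℝ) (x : E) : E →L[ℝ] E →L[ℝ] E :=
  ContinuousLinearMap.compL ℝ E (E →L[ℝ] ℝ) E (G x).inverse ∘L christoffelFirst G x

/-- The linear map `u ↦ R(u, v) w`, where
`R(u, v) w = (∂_u Γ)(v, w) - (∂_v Γ)(u, w) + Γ(u, Γ(v, w)) - Γ(v, Γ(u, w))`. -/
def curvature (G : E → E →L[ℝ] E →L[ℝ] ℝ) (x v w : E) : E →L[ℝ] E :=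
  ((fderiv ℝ (christoffel G) x).flip v).flip w - (fderiv ℝ (christoffel G) x v).flip w
    + (christoffel G x).flip (christoffel G x v w)
    - christoffel G x v ∘L (christoffel G x).flip w

theorem curvature_apply (G : E → E →L[ℝ] E →L[ℝ] ℝ) (x u v w : E) :
    curvature G x v w u =
      fderiv ℝ (christoffel G) x u v w - fderiv ℝ (christoffel G) x v u w
        + christoffel G x u (christoffel G x v w) - christoffel G x v (christoffel G x u w) := by
  simp [curvature]

/-- The Ricci tensor in coordinates: `Ric(v, w)` is the trace of `u ↦ R(u, v) w`. -/
def ricciCoord (G : E → E →L[ℝ] E →L[ℝ] ℝ) (x v w : E) : ℝ :=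
  LinearMap.trace ℝ E (curvature G x v w : E →ₗ[ℝ] E)

/-- The Hessian in coordinates: `Hess h (v, w) = ∂_v ∂_w h - dh(Γ(v, w))`. -/
def hessianCoord (G : E → E →L[ℝ] E →L[ℝ] ℝ) (h : E → ℝ) (x v w : E) : ℝ :=
  fderiv ℝ (fderiv ℝ h) x v w - fderiv ℝ h x (christoffel G x v w)

end Coordinates

/-! ### Semi-Riemannian metrics on manifolds without boundary -/

section Manifold

variable {E : Type*} [NormedAddCommGroup E] [NormedSpace ℝ E]
  {H : Type*} [TopologicalSpace H] (I : ModelWithCorners ℝ E H)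
  {M : Type*} [TopologicalSpace M] [ChartedSpace H M]

/-- A field of bilinear forms on the tangent spaces of `M`. Here and below, the tangent space
`TangentSpace I p` is, as always in Mathlib, a copy of the model space `E`, and we write it as `E`;
the identification is made by the chart at `p`. -/
abbrev FormField (M : Type*) (E : Type*) [NormedAddCommGroup E] [NormedSpace ℝ E] : Type _ :=
  M → E →L[ℝ] E →L[ℝ] ℝ

/-- The differential at `q` of the chart at `p`, a linear map from `T_q M` to `E`. -/
def chartDeriv (p q : M) : E →L[ℝ] E := mfderiv I 𝓘(ℝ, E) (extChartAt I p) q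

/-- The differential at `y` of the inverse of the chart at `p`, a linear map from `E` to `T_q M`,
where `q` is the point of `M` with coordinates `y`. -/
def chartSymmDeriv (p : M) (y : E) : E →L[ℝ] E := mfderiv 𝓘(ℝ, E) I (extChartAt I p).symm y

/-- The expression of `g` in the chart at `p`: the pull-back of `g` by the inverse of that chart.
It is meaningful on the target of the chart. -/
def inChart (g : FormField M E) (p : M) (y : E) : E →L[ℝ] E →L[ℝ] ℝ :=
  (g ((extChartAt I p).symm y)).bilinearComp (chartSymmDeriv I p y) (chartSymmDeriv I p y)

/-- `g` is a (smooth) semi-Riemannian metric: symmetric, nondegenerate, and with smooth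
components in the charts. -/
structure IsMetric (g : FormField M E) : Prop where
  symm : ∀ (p : M) (v w : E), g p v w = g p w v
  nondegenerate : ∀ (p : M) (v : E), (∀ w, g p v w = 0) → v = 0
  smooth : ∀ p : M, ContDiffOn ℝ ∞ (inChart I g p) (extChartAt I p).target

/-- The Ricci tensor of `g` at `p`, computed in the chart at `p`. -/
def ricci (g : FormField M E) (p : M) (v w : E) : ℝ :=
  ricciCoord (inChart I g p) (extChartAt I p p)
    (chartDeriv I p p v) (chartDeriv I p p w)

/-- The Hessian of `h` with respect to `g` at `p`, computed in the chart at `p`. -/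
def hessian (g : FormField M E) (h : M → ℝ) (p : M) (v w : E) : ℝ :=
  hessianCoord (inChart I g p) (h ∘ (extChartAt I p).symm) (extChartAt I p p)
    (chartDeriv I p p v) (chartDeriv I p p w)

/-- `g` is an Einstein metric with constant Ricci curvature `c`: `Ric = c g`. -/
structure IsEinstein (g : FormField M E) (c : ℝ) : Prop where
  isMetric : IsMetric I g
  ricci_eq : ∀ (p : M) (v w : E), ricci I g p v w = c * g p v w

/-- `(M, g)` is a gradient Ricci soliton with potential function `h` and constant `ρ`:
`Ric + Hess h = ρ g`. -/
structure IsGradientRicciSoliton (g : FormField M E) (h : M → ℝ) (ρ : ℝ) : Prop where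
  isMetric : IsMetric I g
  smooth_potential : ContMDiff I 𝓘(ℝ, ℝ) ∞ h
  soliton_eq : ∀ (p : M) (v w : E),
    ricci I g p v w + hessian I g h p v w = ρ * g p v w

end Manifold

section WarpedProduct

variable {E : Type*} [NormedAddCommGroup E] [NormedSpace ℝ E]
  {E' : Type*} [NormedAddCommGroup E'] [NormedSpace ℝ E'] {B F : Type*}

/-- The warped product metric `g_B + f² g_F` on `B × F`, i.e. the sum of the pull-back of `g_B`
by the first projection and `f²` times the pull-back of `g_F` by the second projection. The tangent
space of `B × F` at `p` is the product of those of `B` and `F`. -/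
def warpedProduct (gB : FormField B E) (f : B → ℝ) (gF : FormField F E') :
    FormField (B × F) (E × E') := fun p =>
  (gB p.1).bilinearComp (ContinuousLinearMap.fst ℝ E E') (ContinuousLinearMap.fst ℝ E E')
    + f p.1 ^ 2 •
      (gF p.2).bilinearComp (ContinuousLinearMap.snd ℝ E E') (ContinuousLinearMap.snd ℝ E E')

theorem warpedProduct_apply (gB : FormField B E) (f : B → ℝ) (gF : FormField F E') (p : B × F)
    (v w : E × E') :
    warpedProduct gB f gF p v w = gB p.1 v.1 w.1 + f p.1 ^ 2 * gF p.2 v.2 w.2 := by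
  simp [warpedProduct]

end WarpedProduct

/-- The pseudo-Euclidean metric `g_{ij} = δ_{ij} ε_i` on `ℝⁿ`. -/
def pseudoEuclidean {n : ℕ} (ε : Fin n → ℝ) :
    FormField (EuclideanSpace ℝ (Fin n)) (EuclideanSpace ℝ (Fin n)) := fun _ =>
  ∑ i, ε i • ContinuousLinearMap.smulRight
    (EuclideanSpace.proj i : EuclideanSpace ℝ (Fin n) →L[ℝ] ℝ)
    (EuclideanSpace.proj i : EuclideanSpace ℝ (Fin n) →L[ℝ] ℝ)

theorem pseudoEuclidean_apply {n : ℕ} (ε : Fin n → ℝ) (x v w : EuclideanSpace ℝ (Fin n)) :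
    pseudoEuclidean ε x v w = ∑ i, ε i * (v i * w i) := by
  simp [pseudoEuclidean]

/-- The conformal metric `g / φ²`. -/
def conformal {M E : Type*} [NormedAddCommGroup E] [NormedSpace ℝ E] (g : FormField M E)
    (φ : M → ℝ) : FormField M E := fun x => (1 / φ x ^ 2) • g x

end SemiRiemannian

end

/-!
The Ricci tensor and the Hessian at a point of `M = ℝⁿ × F` are computed in the product chart at
that point. The chart of `ℝⁿ` is the identity, so there the metric `g̃` becomes the coordinate field
`φ(α x)⁻² η + f(α x)² K_y`, where `η` is the constant form `∑ εᵢ dxᵢ²` and `K` is the expression of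
`g_F` in the chart of `F` (`inChart_warpedField`). In coordinates everything is explicit. With
`p = -φ' / φ`, `s = φ² f f'`, `r = f' / f` and `A` the vector dual to `α` under `η`, the Christoffel
symbols are

  `Γ((u, a), (v, b)) =
    (p (α(u) v + α(v) u - η(u, v) A) - s K(a, b) A, Γᴷ(a, b) + r (α(u) b + α(v) a))`

(`IsWarpDatum.christoffel_warpedField`); this is checked against the equation that defines them,
which has only one solution because the metric is nondegenerate. The curvature follows by
differentiating, and its trace over `E × E'` is the sum of the traces of the two diagonal blocks,
each of which is a combination of rank-one maps, a multiple of the identity and, on the fibre, the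
curvature of `K` (`IsWarpDatum.ricciCoord_warpedField`).

When the fibre is Einstein, `Ric + Hess h - ρ g̃` is therefore a combination
`a α ⊗ α + b η + c K` whose three coefficients are, up to nonvanishing factors, the differences of
the two sides of the three differential equations (`IsWarpDatum.ricciCoord_add_hessianCoord`). These
three forms are linearly independent: `η` is detected on the kernel of `α`, which is not zero in
dimension at least two, then `α ⊗ α` on a vector outside that kernel, and `K` on the fibre
(`forall_combination_eq_zero_iff`). As `α` takes all real values, the soliton equation on `M` is
equivalent to the three equations for all `t` (`IsWarpDatum.isGradientRicciSoliton_iff`), whatever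
the value of `∑ εᵢ αᵢ²`. If this value is `0`, the last two equations say `ρ f = 0` and
`ρ f² = λ_F`, i.e. `ρ = λ_F = 0`.
-/

namespace SemiRiemannian

open Filter Topology

/-! ### Metrics, Christoffel symbols and curvature on a coordinate domain -/

section Coordinates

variable {E : Type*} [NormedAddCommGroup E] [NormedSpace ℝ E]

/-- `G` is a semi-Riemannian metric near the point `x` of the coordinate domain: of class `C²`
at `x`, which is what the curvature at `x` requires, and symmetric and nondegenerate at all points
close to `x`. -/
structure IsMetricNear (G : E → E →L[ℝ] E →L[ℝ] ℝ) (x : E) : Prop where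
  contDiffAt : ContDiffAt ℝ 2 G x
  symm : ∀ᶠ y in 𝓝 x, ∀ u v, G y u v = G y v u
  nondegenerate : ∀ᶠ y in 𝓝 x, ∀ u, (∀ w, G y u w = 0) → u = 0

theorem isInvertible_of_nondegenerate [FiniteDimensional ℝ E] {B : E →L[ℝ] E →L[ℝ] ℝ}
    (hB : ∀ u, (∀ w, B u w = 0) → u = 0) : B.IsInvertible := by
  have hinj : Function.Injective (B : E →ₗ[ℝ] E →L[ℝ] ℝ) := by
    rw [← LinearMap.ker_eq_bot, LinearMap.ker_eq_bot']
    intro u hu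
    refine hB u fun w => ?_
    have : B u = 0 := hu
    simp [this]
  have hdim : Module.finrank ℝ E = Module.finrank ℝ (E →L[ℝ] ℝ) := by
    rw [← (LinearMap.toContinuousLinearMap (𝕜 := ℝ) (E := E) (F' := ℝ)).finrank_eq]
    exact (Subspace.dual_finrank_eq (K := ℝ) (V := E)).symm
  refine ⟨(LinearEquiv.ofInjectiveOfFinrankEq (B : E →ₗ[ℝ] E →L[ℝ] ℝ) hinj
    hdim).toContinuousLinearEquiv, ?_⟩
  ext u w
  rfl

variable {G : E → E →L[ℝ] E →L[ℝ] ℝ} {x : E}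

theorem fderiv_apply_apply {E₁ E₂ E₃ : Type*} [NormedAddCommGroup E₁] [NormedSpace ℝ E₁]
    [NormedAddCommGroup E₂] [NormedSpace ℝ E₂] [NormedAddCommGroup E₃] [NormedSpace ℝ E₃]
    {T : E → E₁ →L[ℝ] E₂ →L[ℝ] E₃} (hT : DifferentiableAt ℝ T x) (u : E) (v : E₁) (w : E₂) :
    fderiv ℝ T x u v w = fderiv ℝ (fun y => T y v w) x u := by
  have := (hT.hasFDerivAt.clm_apply (hasFDerivAt_const v x)).clm_apply (hasFDerivAt_const w x)
  rw [this.fderiv]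
  simp

theorem apply_christoffel [FiniteDimensional ℝ E] (hG : ∀ u, (∀ w, G x u w = 0) → u = 0)
    (u v w : E) : G x (christoffel G x u v) w = christoffelFirst G x u v w := by
  have := (isInvertible_of_nondegenerate hG).self_apply_inverse (christoffelFirst G x u v)
  simpa [christoffel] using congrArg (fun l => l w) this

/-- For a nondegenerate metric the Christoffel symbols are the only solution of the equation that
defines them, so that a proposed formula need only be checked against this equation. -/
theorem christoffel_eq_of_forall_apply [FiniteDimensional ℝ E]
    (hG : ∀ u, (∀ w, G x u w = 0) → u = 0) {u v z : E}
    (hz : ∀ w, G x z w = christoffelFirst G x u v w) : christoffel G x u v = z := by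
  refine sub_eq_zero.1 (hG _ fun w => ?_)
  rw [map_sub, sub_apply, apply_christoffel hG, hz, sub_self]

namespace IsMetricNear

theorem eventually (hG : IsMetricNear G x) : ∀ᶠ y in 𝓝 x, IsMetricNear G y := by
  filter_upwards [hG.contDiffAt.eventually (by simp), hG.symm.eventually_nhds,
    hG.nondegenerate.eventually_nhds] with y h₁ h₂ h₃
  exact ⟨h₁, h₂, h₃⟩

theorem differentiableAt (hG : IsMetricNear G x) : DifferentiableAt ℝ G x :=
  hG.contDiffAt.differentiableAt (by simp)

theorem fderiv_symm (hG : IsMetricNear G x) (u v w : E) :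
    fderiv ℝ G x u v w = fderiv ℝ G x u w v := by
  rw [fderiv_apply_apply hG.differentiableAt, fderiv_apply_apply hG.differentiableAt]
  exact congrArg (fun L => L u) (EventuallyEq.fderiv_eq (𝕜 := ℝ) (hG.symm.mono fun y hy => hy v w))

theorem christoffel_symm [FiniteDimensional ℝ E] (hG : IsMetricNear G x) (u v : E) :
    christoffel G x u v = christoffel G x v u := by
  refine christoffel_eq_of_forall_apply hG.nondegenerate.self_of_nhds fun w => ?_
  rw [apply_christoffel hG.nondegenerate.self_of_nhds, christoffelFirst_apply,
    christoffelFirst_apply, hG.fderiv_symm w u v]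
  ring

theorem differentiableAt_christoffel [FiniteDimensional ℝ E] (hG : IsMetricNear G x) :
    DifferentiableAt ℝ (christoffel G) x := by
  have : CompleteSpace E := FiniteDimensional.complete ℝ E
  have hinv : DifferentiableAt ℝ (fun y => (G y).inverse) x :=
    (((isInvertible_of_nondegenerate hG.nondegenerate.self_of_nhds).contDiffAt_map_inverse
      (n := 1)).differentiableAt (by simp)).comp x hG.differentiableAt
  have hfd : DifferentiableAt ℝ (fderiv ℝ G) x :=
    (hG.contDiffAt.fderiv_right (m := 1) (by norm_cast)).differentiableAt (by simp)
  have hflip : ∀ {f : E → E →L[ℝ] E →L[ℝ] E →L[ℝ] ℝ}, DifferentiableAt ℝ f x →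
      DifferentiableAt ℝ (fun y => (f y).flip) x := fun hf =>
    (ContinuousLinearMap.flipₗᵢ ℝ E E (E →L[ℝ] ℝ)).differentiableAt.comp x hf
  have hfirst : DifferentiableAt ℝ (christoffelFirst G) x := by
    have hsub := (hfd.add (hflip hfd)).sub
      ((differentiableAt_const ((ContinuousLinearMap.flipₗᵢ ℝ E E ℝ).toContinuousLinearEquiv :
        (E →L[ℝ] E →L[ℝ] ℝ) →L[ℝ] E →L[ℝ] E →L[ℝ] ℝ)).clm_comp (hflip hfd))
    exact hsub.const_smul (1 / 2 : ℝ)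
  unfold christoffel
  exact ((ContinuousLinearMap.compL ℝ E (E →L[ℝ] ℝ) E).differentiableAt.comp x hinv).clm_comp hfirst

end IsMetricNear

theorem christoffelFirst_congr {G' : E → E →L[ℝ] E →L[ℝ] ℝ} (h : G =ᶠ[𝓝 x] G') :
    christoffelFirst G x = christoffelFirst G' x := by
  simp only [christoffelFirst, h.fderiv_eq]

theorem christoffel_congr {G' : E → E →L[ℝ] E →L[ℝ] ℝ} (h : G =ᶠ[𝓝 x] G') :
    christoffel G x = christoffel G' x := by
  simp only [christoffel, christoffelFirst_congr h, h.self_of_nhds]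

theorem ricciCoord_congr {G' : E → E →L[ℝ] E →L[ℝ] ℝ} (h : G =ᶠ[𝓝 x] G') :
    ricciCoord G x = ricciCoord G' x := by
  have hΓ : christoffel G =ᶠ[𝓝 x] christoffel G' :=
    h.eventuallyEq_nhds.mono fun y hy => christoffel_congr hy
  ext v w
  simp only [ricciCoord, curvature, hΓ.fderiv_eq, hΓ.self_of_nhds]

theorem hessianCoord_congr {G' : E → E →L[ℝ] E →L[ℝ] ℝ} (h : G =ᶠ[𝓝 x] G') (k : E → ℝ) :
    hessianCoord G k x = hessianCoord G' k x := by
  ext v w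
  simp only [hessianCoord, christoffel_congr h]

end Coordinates

/-- The trace of an endomorphism of a product is the sum of the traces of its diagonal blocks. -/
theorem trace_eq_trace_add_trace {V W : Type*} [AddCommGroup V] [Module ℝ V]
    [AddCommGroup W] [Module ℝ W] [FiniteDimensional ℝ V] [FiniteDimensional ℝ W]
    (T : V × W →ₗ[ℝ] V × W) :
    LinearMap.trace ℝ (V × W) T =
      LinearMap.trace ℝ V (LinearMap.fst ℝ V W ∘ₗ T ∘ₗ LinearMap.inl ℝ V W) +
        LinearMap.trace ℝ W (LinearMap.snd ℝ V W ∘ₗ T ∘ₗ LinearMap.inr ℝ V W) := by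
  rw [LinearMap.trace_comp_comm' (T ∘ₗ LinearMap.inl ℝ V W) (LinearMap.fst ℝ V W),
    LinearMap.trace_comp_comm' (T ∘ₗ LinearMap.inr ℝ V W) (LinearMap.snd ℝ V W), ← map_add]
  congr 1
  ext p <;> simp [show ((0 : V), (0 : W)) = 0 from rfl]

/-! ### Curvature of a conformally flat warped product in coordinates -/

theorem contDiff_bilinearComp {E₁ E₂ E₃ E₄ : Type*} [NormedAddCommGroup E₁] [NormedSpace ℝ E₁]
    [NormedAddCommGroup E₂] [NormedSpace ℝ E₂] [NormedAddCommGroup E₃] [NormedSpace ℝ E₃]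
    [NormedAddCommGroup E₄] [NormedSpace ℝ E₄] {k : WithTop ℕ∞} (L : E₃ →L[ℝ] E₁)
    (L' : E₄ →L[ℝ] E₂) :
    ContDiff ℝ k fun B : E₁ →L[ℝ] E₂ →L[ℝ] ℝ => B.bilinearComp L L' :=
  (ContinuousLinearMap.flipₗᵢ ℝ E₄ E₃ ℝ).contDiff.comp
    (((ContinuousLinearMap.flipₗᵢ ℝ E₃ E₂ ℝ).contDiff.comp
      (contDiff_id.clm_comp contDiff_const)).clm_comp contDiff_const)

section WarpedCoordinates

variable {E : Type*} [NormedAddCommGroup E] [NormedSpace ℝ E]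
  {E' : Type*} [NormedAddCommGroup E'] [NormedSpace ℝ E']

/-- The data of a conformally flat base with a warping function, both depending only on the linear
form `α`: a constant nondegenerate symmetric form `η`, the vector `A` dual to `α` under `η`, the
conformal factor `φ` and the warping function `f`. -/
structure IsWarpDatum (η : E →L[ℝ] E →L[ℝ] ℝ) (α : E →L[ℝ] ℝ) (A : E) (φ f : ℝ → ℝ) : Prop where
  symm : ∀ u v, η u v = η v u
  nondegenerate : ∀ u, (∀ w, η u w = 0) → u = 0
  dual : ∀ v, η A v = α v
  contDiff_conformal : ContDiff ℝ ∞ φ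
  contDiff_warp : ContDiff ℝ ∞ f
  conformal_ne_zero : ∀ t, φ t ≠ 0
  warp_pos : ∀ t, 0 < f t

/-- The warped product metric `φ(α x)⁻² η + f(α x)² K_y` on `E × F`, where the fibre `F` is a
manifold or a coordinate domain in `E'`. -/
noncomputable def warpedField (η : E →L[ℝ] E →L[ℝ] ℝ) (α : E →L[ℝ] ℝ) (φ f : ℝ → ℝ)
    {F : Type*} (K : FormField F E') : FormField (E × F) (E × E') :=
  warpedProduct (conformal (fun _ => η) fun x => φ (α x)) (fun x => f (α x)) K

/-- The bilinear map `(u, v) ↦ α(u) v + α(v) u - η(u, v) A`, by which the Christoffel symbols of a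
constant form `η` change, up to a factor, under a conformal change by a function of `α`. -/
noncomputable def conformalTerm (η : E →L[ℝ] E →L[ℝ] ℝ) (α : E →L[ℝ] ℝ) (A u v : E) : E :=
  α u • v + α v • u - η u v • A

variable {η : E →L[ℝ] E →L[ℝ] ℝ} {α : E →L[ℝ] ℝ} {A : E} {φ f : ℝ → ℝ}
  {K : E' → E' →L[ℝ] E' →L[ℝ] ℝ} {z : E × E'}

theorem warpedField_apply {F : Type*} (K : FormField F E') (z : E × F) (v w : E × E') :
    warpedField η α φ f K z v w =
      1 / φ (α z.1) ^ 2 * η v.1 w.1 + f (α z.1) ^ 2 * K z.2 v.2 w.2 := by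
  simp [warpedField, warpedProduct_apply, conformal]

namespace IsWarpDatum

theorem hasDerivAt_conformal (hd : IsWarpDatum η α A φ f) (t : ℝ) :
    HasDerivAt φ (deriv φ t) t :=
  (hd.contDiff_conformal.differentiable (by simp) t).hasDerivAt

theorem hasDerivAt_warp (hd : IsWarpDatum η α A φ f) (t : ℝ) :
    HasDerivAt f (deriv f t) t :=
  (hd.contDiff_warp.differentiable (by simp) t).hasDerivAt

theorem hasDerivAt_deriv_conformal (hd : IsWarpDatum η α A φ f) (t : ℝ) :
    HasDerivAt (deriv φ) (deriv (deriv φ) t) t :=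
  ((contDiff_infty_iff_deriv.1 hd.contDiff_conformal).2.differentiable (by simp) t).hasDerivAt

theorem hasDerivAt_deriv_warp (hd : IsWarpDatum η α A φ f) (t : ℝ) :
    HasDerivAt (deriv f) (deriv (deriv f) t) t :=
  ((contDiff_infty_iff_deriv.1 hd.contDiff_warp).2.differentiable (by simp) t).hasDerivAt

theorem contDiffAt_warpedField (hd : IsWarpDatum η α A φ f) {k : WithTop ℕ∞} (hk : k ≤ ∞)
    (hK : ContDiffAt ℝ k K z.2) : ContDiffAt ℝ k (warpedField η α φ f K) z := by
  have hα : ContDiffAt ℝ k (fun z : E × E' => α z.1) z := by fun_prop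
  have hφ : ContDiffAt ℝ k (fun z : E × E' => φ (α z.1)) z :=
    (hd.contDiff_conformal.of_le hk).contDiffAt.comp z hα
  have hf : ContDiffAt ℝ k (fun z : E × E' => f (α z.1)) z :=
    (hd.contDiff_warp.of_le hk).contDiffAt.comp z hα
  have hK' : ContDiffAt ℝ k (fun z : E × E' => K z.2) z := hK.comp z contDiffAt_snd
  have h1 : ContDiffAt ℝ k (fun z : E × E' => (1 / φ (α z.1) ^ 2) • η) z :=
    (contDiffAt_const.div (hφ.pow 2) (pow_ne_zero _ (hd.conformal_ne_zero _))).smul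
      contDiffAt_const
  exact ((contDiff_bilinearComp _ _).contDiffAt.comp z h1).add
    ((hf.pow 2).smul ((contDiff_bilinearComp _ _).contDiffAt.comp z hK'))

theorem warpedField_nondegenerate (hd : IsWarpDatum η α A φ f) {F : Type*} {K : FormField F E'}
    {z : E × F} (hK : ∀ u, (∀ w, K z.2 u w = 0) → u = 0) {u : E × E'}
    (hu : ∀ w, warpedField η α φ f K z u w = 0) : u = 0 := by
  simp only [warpedField_apply] at hu
  have h1 := hd.nondegenerate u.1 fun w => by
    simpa [hd.conformal_ne_zero] using hu (w, 0)
  have h2 := hK u.2 fun w => by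
    simpa [(hd.warp_pos _).ne'] using hu (0, w)
  exact Prod.ext h1 h2

theorem isMetricNear_warpedField (hd : IsWarpDatum η α A φ f) (hK : IsMetricNear K z.2) :
    IsMetricNear (warpedField η α φ f K) z where
  contDiffAt := hd.contDiffAt_warpedField (by norm_cast) hK.contDiffAt
  symm := by
    filter_upwards [continuousAt_snd.eventually hK.symm] with y hy u v
    rw [warpedField_apply, warpedField_apply, hd.symm, hy]
  nondegenerate := by
    filter_upwards [continuousAt_snd.eventually hK.nondegenerate] with y hy u hu
    exact hd.warpedField_nondegenerate hy hu

theorem fderiv_warpedField (hd : IsWarpDatum η α A φ f) (hK : IsMetricNear K z.2)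
    (u v w : E × E') :
    fderiv ℝ (warpedField η α φ f K) z u v w =
      -(2 * deriv φ (α z.1) / φ (α z.1) ^ 3) * α u.1 * η v.1 w.1
        + 2 * f (α z.1) * deriv f (α z.1) * α u.1 * K z.2 v.2 w.2
        + f (α z.1) ^ 2 * fderiv ℝ K z.2 u.2 v.2 w.2 := by
  rw [fderiv_apply_apply (hd.isMetricNear_warpedField hK).differentiableAt,
    fderiv_apply_apply hK.differentiableAt]
  have hα : HasFDerivAt (fun z : E × E' => α z.1) (α ∘L ContinuousLinearMap.fst ℝ E E') z :=
    α.hasFDerivAt.comp z hasFDerivAt_fst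
  have hφ := ((((hd.hasDerivAt_conformal (α z.1)).pow 2).fun_inv
    (pow_ne_zero _ (hd.conformal_ne_zero _))).comp_hasFDerivAt z hα).mul_const (η v.1 w.1)
  have hf := ((hd.hasDerivAt_warp (α z.1)).pow 2).comp_hasFDerivAt z hα
  have hk : DifferentiableAt ℝ (fun y => K y v.2 w.2) z.2 :=
    (hK.differentiableAt.clm_apply (differentiableAt_const _)).clm_apply (differentiableAt_const _)
  have hk' : HasFDerivAt (fun z : E × E' => K z.2 v.2 w.2)
    (fderiv ℝ (fun y => K y v.2 w.2) z.2 ∘L ContinuousLinearMap.snd ℝ E E') z :=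
    hk.hasFDerivAt.comp z hasFDerivAt_snd
  have hfun : (fun y => warpedField η α φ f K y v w) = fun y : E × E' =>
      (φ (α y.1) ^ 2)⁻¹ * η v.1 w.1 + f (α y.1) ^ 2 * K y.2 v.2 w.2 := by
    ext y
    rw [warpedField_apply, one_div]
  rw [hfun]
  refine (congrArg (fun L => L u) (HasFDerivAt.fderiv (hφ.add (hf.mul hk')))).trans ?_
  have := hd.conformal_ne_zero (α z.1)
  simp
  field_simp
  ring

/-- The Christoffel symbols of the warped product metric. -/
theorem christoffel_warpedField [FiniteDimensional ℝ E] [FiniteDimensional ℝ E']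
    (hd : IsWarpDatum η α A φ f) (hK : IsMetricNear K z.2) (v w : E × E') :
    christoffel (warpedField η α φ f K) z v w =
      ((-(deriv φ (α z.1) / φ (α z.1))) • conformalTerm η α A v.1 w.1
          - (φ (α z.1) ^ 2 * f (α z.1) * deriv f (α z.1) * K z.2 v.2 w.2) • A,
        christoffel K z.2 v.2 w.2
          + (deriv f (α z.1) / f (α z.1)) • (α v.1 • w.2 + α w.1 • v.2)) := by
  refine christoffel_eq_of_forall_apply
    (hd.isMetricNear_warpedField hK).nondegenerate.self_of_nhds fun u => ?_
  have h1 := hd.conformal_ne_zero (α z.1)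
  have h2 := (hd.warp_pos (α z.1)).ne'
  rw [christoffelFirst_apply, warpedField_apply]
  simp only [hd.fderiv_warpedField hK]
  simp only [map_add, map_sub, map_smul, add_apply, sub_apply,
    smul_apply, smul_eq_mul, conformalTerm, hd.dual,
    apply_christoffel hK.nondegenerate.self_of_nhds, christoffelFirst_apply]
  field_simp
  ring

/-- The derivative at `z`, in the direction `u`, of the Christoffel symbols applied to the fixed
vectors `v` and `w`. -/
theorem fderiv_christoffel_warpedField [FiniteDimensional ℝ E] [FiniteDimensional ℝ E']
    (hd : IsWarpDatum η α A φ f) (hK : IsMetricNear K z.2) {p s r : ℝ → ℝ} {p' s' r' : ℝ}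
    (hp : ∀ t, p t = -(deriv φ t / φ t)) (hs : ∀ t, s t = φ t ^ 2 * f t * deriv f t)
    (hr : ∀ t, r t = deriv f t / f t) (hp' : HasDerivAt p p' (α z.1))
    (hs' : HasDerivAt s s' (α z.1)) (hr' : HasDerivAt r r' (α z.1)) (u v w : E × E') :
    fderiv ℝ (christoffel (warpedField η α φ f K)) z u v w =
      ((p' * α u.1) • conformalTerm η α A v.1 w.1
          - (s' * α u.1 * K z.2 v.2 w.2 + s (α z.1) * fderiv ℝ K z.2 u.2 v.2 w.2) • A,
        fderiv ℝ (christoffel K) z.2 u.2 v.2 w.2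
          + (r' * α u.1) • (α v.1 • w.2 + α w.1 • v.2)) := by
  have hG := hd.isMetricNear_warpedField hK
  rw [fderiv_apply_apply hG.differentiableAt_christoffel, fderiv_apply_apply hK.differentiableAt,
    fderiv_apply_apply hK.differentiableAt_christoffel]
  have hα : HasFDerivAt (fun z : E × E' => α z.1) (α ∘L ContinuousLinearMap.fst ℝ E E') z :=
    α.hasFDerivAt.comp z hasFDerivAt_fst
  have hk : DifferentiableAt ℝ (fun y => K y v.2 w.2) z.2 :=
    (hK.differentiableAt.clm_apply (differentiableAt_const _)).clm_apply (differentiableAt_const _)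
  have hk' : HasFDerivAt (fun z : E × E' => K z.2 v.2 w.2)
    (fderiv ℝ (fun y => K y v.2 w.2) z.2 ∘L ContinuousLinearMap.snd ℝ E E') z :=
    hk.hasFDerivAt.comp z hasFDerivAt_snd
  have hΓ : DifferentiableAt ℝ (fun y => christoffel K y v.2 w.2) z.2 :=
    (hK.differentiableAt_christoffel.clm_apply (differentiableAt_const _)).clm_apply
      (differentiableAt_const _)
  have hΓ' : HasFDerivAt (fun z : E × E' => christoffel K z.2 v.2 w.2)
    (fderiv ℝ (fun y => christoffel K y v.2 w.2) z.2 ∘L ContinuousLinearMap.snd ℝ E E') z :=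
    hΓ.hasFDerivAt.comp z hasFDerivAt_snd
  have hfst := ((hp'.comp_hasFDerivAt z hα).smul_const (conformalTerm η α A v.1 w.1)).sub
    (((hs'.comp_hasFDerivAt z hα).mul hk').smul_const A)
  have hsnd := hΓ'.add ((hr'.comp_hasFDerivAt z hα).smul_const (α v.1 • w.2 + α w.1 • v.2))
  have hev : (fun y => christoffel (warpedField η α φ f K) y v w) =ᶠ[𝓝 z] fun y : E × E' =>
      (p (α y.1) • conformalTerm η α A v.1 w.1 - (s (α y.1) * K y.2 v.2 w.2) • A,
        christoffel K y.2 v.2 w.2 + r (α y.1) • (α v.1 • w.2 + α w.1 • v.2)) := by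
    filter_upwards [continuousAt_snd.eventually hK.eventually] with y hy
    rw [hd.christoffel_warpedField hy, hp, hs, hr]
  rw [hev.fderiv_eq]
  refine (congrArg (fun L => L u) (HasFDerivAt.fderiv (hfst.prodMk hsnd))).trans ?_
  refine Prod.ext ?_ ?_
  · simp [mul_comm, add_comm]
  · simp

/-- The Ricci tensor of the warped product metric, in terms of the coefficients `p = -φ' / φ`,
`s = φ² f f'` and `r = f' / f` of its Christoffel symbols. -/
theorem ricciCoord_warpedField [FiniteDimensional ℝ E] [FiniteDimensional ℝ E']
    (hd : IsWarpDatum η α A φ f) (hK : IsMetricNear K z.2) {p s r : ℝ → ℝ} {p' s' r' : ℝ}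
    (hp : ∀ t, p t = -(deriv φ t / φ t)) (hs : ∀ t, s t = φ t ^ 2 * f t * deriv f t)
    (hr : ∀ t, r t = deriv f t / f t) (hp' : HasDerivAt p p' (α z.1))
    (hs' : HasDerivAt s s' (α z.1)) (hr' : HasDerivAt r r' (α z.1)) (v w : E × E') :
    ricciCoord (warpedField η α φ f K) z v w =
      ricciCoord K z.2 v.2 w.2
        + ((2 - Module.finrank ℝ E) * p' + (Module.finrank ℝ E - 2) * p (α z.1) ^ 2
            + Module.finrank ℝ E' * (2 * r (α z.1) * p (α z.1) - r' - r (α z.1) ^ 2))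
          * (α v.1 * α w.1)
        + α A * (-p' + 2 * p (α z.1) ^ 2 - Module.finrank ℝ E * p (α z.1) ^ 2
            - Module.finrank ℝ E' * r (α z.1) * p (α z.1)) * η v.1 w.1
        + α A * (-s' + 2 * s (α z.1) * r (α z.1) - Module.finrank ℝ E * p (α z.1) * s (α z.1)
            - Module.finrank ℝ E' * r (α z.1) * s (α z.1)) * K z.2 v.2 w.2 := by
  set P := p (α z.1) with hP
  set S := s (α z.1) with hS
  set R := r (α z.1) with hR
  set k := K z.2 v.2 w.2 with hk
  set X : E := P • conformalTerm η α A v.1 w.1 - (S * k) • A with hX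
  have hΓ : ∀ v w : E × E', christoffel (warpedField η α φ f K) z v w =
      (P • conformalTerm η α A v.1 w.1 - (S * K z.2 v.2 w.2) • A,
        christoffel K z.2 v.2 w.2 + R • (α v.1 • w.2 + α w.1 • v.2)) := fun v w => by
    rw [hd.christoffel_warpedField hK, hP, hS, hR, hp, hs, hr]
  have hdΓ := hd.fderiv_christoffel_warpedField hK hp hs hr hp' hs' hr'
  have hAA : ∀ u, η u A = α u := fun u => by rw [hd.symm, hd.dual]
  rw [ricciCoord, trace_eq_trace_add_trace]
  -- The base block `u ↦ fst (R((u, 0), v) w)`, sorted by the way in which `u` enters.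
  have hbase : LinearMap.fst ℝ E E' ∘ₗ
      (curvature (warpedField η α φ f K) z v w : E × E' →ₗ[ℝ] E × E') ∘ₗ LinearMap.inl ℝ E E' =
      (α : E →ₗ[ℝ] ℝ).smulRight (p' • conformalTerm η α A v.1 w.1 - (s' * k) • A
          - (p' * α v.1) • w.1 + P • X - (P ^ 2 * α v.1) • w.1 - (2 * P ^ 2 * α w.1) • v.1
          + (P ^ 2 * η v.1 w.1) • A + (S * R * k) • A)
        + (P * α X - p' * α v.1 * α w.1 - P ^ 2 * α v.1 * α w.1) • LinearMap.id
        + (η ((p' * α v.1) • w.1 - P • X + (P ^ 2 * α w.1) • v.1) : E →ₗ[ℝ] ℝ).smulRight A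
        + (η w.1 : E →ₗ[ℝ] ℝ).smulRight ((P ^ 2 * α A) • v.1) := by
    refine LinearMap.ext fun u => ?_
    simp only [LinearMap.comp_apply, LinearMap.inl_apply, LinearMap.fst_apply,
      ContinuousLinearMap.coe_coe, curvature_apply, hΓ, hdΓ]
    simp only [hX, conformalTerm, hAA, hd.dual, hd.symm u v.1, hd.symm u w.1,
      LinearMap.add_apply, LinearMap.smul_apply,
      LinearMap.smulRight_apply, LinearMap.id_apply, ContinuousLinearMap.coe_coe, map_add,
      map_sub, map_smul, map_zero, Prod.fst_add, Prod.fst_sub, add_apply, sub_apply, smul_apply,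
      zero_apply, smul_eq_mul, smul_zero, zero_smul, mul_zero, add_zero, zero_add, sub_zero, ← hk,
      ← hS]
    module
  -- The fibre block `a ↦ snd (R((0, a), v) w)`; the terms in `Γᴷ` that are not part of the
  -- curvature of `K` cancel by the symmetry of `Γᴷ`.
  have hfiber : LinearMap.snd ℝ E E' ∘ₗ
      (curvature (warpedField η α φ f K) z v w : E × E' →ₗ[ℝ] E × E') ∘ₗ LinearMap.inr ℝ E E' =
      (curvature K z.2 v.2 w.2 : E' →ₗ[ℝ] E')
        + (R * α X - r' * α v.1 * α w.1 - R ^ 2 * α v.1 * α w.1) • LinearMap.id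
        + (K z.2 w.2 : E' →ₗ[ℝ] ℝ).smulRight ((R * S * α A) • v.2) := by
    refine LinearMap.ext fun a => ?_
    simp only [LinearMap.comp_apply, LinearMap.inr_apply, LinearMap.snd_apply,
      ContinuousLinearMap.coe_coe, curvature_apply, hΓ, hdΓ]
    simp only [curvature_apply, hX, conformalTerm, hAA, hK.christoffel_symm v.2 a,
      hK.symm.self_of_nhds a w.2, LinearMap.add_apply, LinearMap.smul_apply,
      LinearMap.smulRight_apply,
      LinearMap.id_apply, ContinuousLinearMap.coe_coe, map_add,
      map_sub, map_smul, map_zero, Prod.snd_add, Prod.snd_sub, zero_apply, smul_eq_mul, smul_zero,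
      zero_smul, mul_zero, zero_mul, add_zero, zero_add, sub_zero, ← hk, ← hS]
    module
  rw [hbase, hfiber]
  simp only [map_add, map_smul, map_sub, LinearMap.trace_smulRight, LinearMap.trace_id]
  simp only [hX, conformalTerm, hAA, map_add, map_sub, map_smul, smul_eq_mul,
    ContinuousLinearMap.coe_coe, ricciCoord, add_apply, sub_apply, smul_apply]
  rw [hd.symm w.1 v.1, hK.symm.self_of_nhds w.2 v.2, ← hk]
  ring

end IsWarpDatum

end WarpedCoordinates

/-! ### The soliton tensor in coordinates -/

section WarpedSoliton

variable {E : Type*} [NormedAddCommGroup E] [NormedSpace ℝ E]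
  {E' : Type*} [NormedAddCommGroup E'] [NormedSpace ℝ E']

variable {η : E →L[ℝ] E →L[ℝ] ℝ} {α : E →L[ℝ] ℝ} {A : E} {φ f : ℝ → ℝ}
  {K : E' → E' →L[ℝ] E' →L[ℝ] ℝ} {z : E × E'}

namespace IsWarpDatum

theorem hessianCoord_warpedField [FiniteDimensional ℝ E] [FiniteDimensional ℝ E']
    (hd : IsWarpDatum η α A φ f) (hK : IsMetricNear K z.2) {h : ℝ → ℝ} (hh : ContDiff ℝ ∞ h)
    (v w : E × E') :
    hessianCoord (warpedField η α φ f K) (fun y => h (α y.1)) z v w =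
      deriv (deriv h) (α z.1) * (α v.1 * α w.1)
        - deriv h (α z.1) * (-(deriv φ (α z.1) / φ (α z.1))
              * (2 * (α v.1 * α w.1) - α A * η v.1 w.1)
            - φ (α z.1) ^ 2 * f (α z.1) * deriv f (α z.1) * α A * K z.2 v.2 w.2) := by
  have hα : ∀ z : E × E',
      HasFDerivAt (fun z : E × E' => α z.1) (α ∘L ContinuousLinearMap.fst ℝ E E') z := fun z =>
    α.hasFDerivAt.comp z hasFDerivAt_fst
  have h1 : ∀ y : E × E', fderiv ℝ (fun y : E × E' => h (α y.1)) y =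
      deriv h (α y.1) • (α ∘L ContinuousLinearMap.fst ℝ E E') := fun y =>
    ((hh.differentiable (by simp) (α y.1)).hasDerivAt.comp_hasFDerivAt y (hα y)).fderiv
  have h2 := ((contDiff_infty_iff_deriv.1 hh).2.differentiable (by simp) (α z.1)).hasDerivAt
  rw [hessianCoord, h1, funext h1]
  have h3 := (h2.comp_hasFDerivAt z (hα z)).smul_const (α ∘L ContinuousLinearMap.fst ℝ E E')
  have h4 : fderiv ℝ (fun y : E × E' => deriv h (α y.1) • (α ∘L ContinuousLinearMap.fst ℝ E E')) z =
    _ := h3.fderiv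
  rw [h4, hd.christoffel_warpedField hK]
  simp [conformalTerm]
  ring

/-- The tensor `Ric + Hess h - ρ g` of the warped product metric, over a fibre whose Ricci tensor
is `lam K` at the given point, is a combination of the three forms `α ⊗ α`, `η` and `K`. -/
theorem ricciCoord_add_hessianCoord [FiniteDimensional ℝ E] [FiniteDimensional ℝ E']
    (hd : IsWarpDatum η α A φ f) (hK : IsMetricNear K z.2) {h : ℝ → ℝ} (hh : ContDiff ℝ ∞ h)
    {lam : ℝ} (hlam : ∀ b c, ricciCoord K z.2 b c = lam * K z.2 b c)
    (ρ n m κ t : ℝ) (hn : (Module.finrank ℝ E : ℝ) = n) (hm : (Module.finrank ℝ E' : ℝ) = m)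
    (hκ : α A = κ) (ht : α z.1 = t) (v w : E × E') :
    ricciCoord (warpedField η α φ f K) z v w
        + hessianCoord (warpedField η α φ f K) (fun y => h (α y.1)) z v w
        - ρ * warpedField η α φ f K z v w =
      ((n - 2) * f t * deriv (deriv φ) t + f t * φ t * deriv (deriv h) t
          - m * φ t * deriv (deriv f) t - 2 * m * deriv φ t * deriv f t
          + 2 * f t * deriv φ t * deriv h t) / (f t * φ t) * (α v.1 * α w.1)
        + (κ * (f t * φ t * deriv (deriv φ) t - (n - 1) * f t * deriv φ t ^ 2
            + m * φ t * deriv φ t * deriv f t - f t * φ t * deriv φ t * deriv h t) - ρ * f t)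
          / (f t * φ t ^ 2) * η v.1 w.1
        + (κ * (-(f t * φ t ^ 2 * deriv (deriv f) t) + (n - 2) * f t * φ t * deriv φ t * deriv f t
            - (m - 1) * φ t ^ 2 * deriv f t ^ 2 + f t * φ t ^ 2 * deriv f t * deriv h t)
            - (ρ * f t ^ 2 - lam)) * K z.2 v.2 w.2 := by
  have hφ0 := hd.conformal_ne_zero t
  have hf0 := (hd.warp_pos t).ne'
  have hp' := ((hd.hasDerivAt_deriv_conformal t).fun_div (hd.hasDerivAt_conformal t) hφ0).fun_neg
  have hs' := (((hd.hasDerivAt_conformal t).fun_pow 2).fun_mul (hd.hasDerivAt_warp t)).fun_mul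
    (hd.hasDerivAt_deriv_warp t)
  have hr' := (hd.hasDerivAt_deriv_warp t).fun_div (hd.hasDerivAt_warp t) hf0
  rw [← ht] at hp' hs' hr'
  rw [hd.ricciCoord_warpedField hK (fun _ => rfl) (fun _ => rfl) (fun _ => rfl) hp' hs' hr',
    hd.hessianCoord_warpedField hK hh, warpedField_apply, hlam, hn, hm, hκ, ht]
  field_simp
  ring

end IsWarpDatum

/-- When `E` has dimension at least two and `E'` is not zero, the forms `α ⊗ α`, `η` and `K` on
`E × E'` are linearly independent. -/
theorem forall_combination_eq_zero_iff [FiniteDimensional ℝ E] [Nontrivial E']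
    (hdim : 2 ≤ Module.finrank ℝ E) (hα : α ≠ 0)
    (hη : ∀ u, (∀ w, η u w = 0) → u = 0) {k : E' →L[ℝ] E' →L[ℝ] ℝ}
    (hk : ∀ u, (∀ w, k u w = 0) → u = 0) {a b c : ℝ} :
    (∀ v w : E × E', a * (α v.1 * α w.1) + b * η v.1 w.1 + c * k v.2 w.2 = 0) ↔
      a = 0 ∧ b = 0 ∧ c = 0 := by
  refine ⟨fun H => ?_, ?_⟩
  · have hb : b = 0 := by
      have hker : LinearMap.ker (α : E →ₗ[ℝ] ℝ) ≠ ⊥ := by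
        intro h0
        have := LinearMap.finrank_range_add_finrank_ker (α : E →ₗ[ℝ] ℝ)
        rw [h0, finrank_bot] at this
        have := (LinearMap.range (α : E →ₗ[ℝ] ℝ)).finrank_le
        rw [Module.finrank_self] at this
        omega
      obtain ⟨u, hu, hu0⟩ := Submodule.exists_mem_ne_zero_of_ne_bot hker
      have hu : α u = 0 := hu
      by_contra hb
      refine hu0 (hη u fun w => ?_)
      simpa [hu, hb] using H (u, 0) (w, 0)
    have ha : a = 0 := by
      obtain ⟨u, hu⟩ : ∃ u, α u ≠ 0 := by
        by_contra! h0
        exact hα (ContinuousLinearMap.ext h0)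
      simpa [hu, hb] using H (u, 0) (u, 0)
    have hc : c = 0 := by
      obtain ⟨u, hu⟩ := exists_ne (0 : E')
      by_contra hc
      refine hu (hk u fun w => ?_)
      simpa [hc] using H (0, u) (0, w)
    exact ⟨ha, hb, hc⟩
  · rintro ⟨rfl, rfl, rfl⟩ v w
    simp

end WarpedSoliton

/-! ### Passage between a manifold and its charts -/

section Charts

variable {E : Type*} [NormedAddCommGroup E] [NormedSpace ℝ E]
  {H : Type*} [TopologicalSpace H] (I : ModelWithCorners ℝ E H)
  {M : Type*} [TopologicalSpace M] [ChartedSpace H M] (p : M)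

/-- The tangent space at `p` is identified with the model space by the chart at `p`, so the
differential of that chart at `p` is the identity. -/
theorem chartDeriv_self [IsManifold I 1 M] : chartDeriv I p p = ContinuousLinearMap.id ℝ E := by
  ext v
  have h1 : MDifferentiableAt I 𝓘(ℝ, E) (extChartAt I p) p :=
    mdifferentiableAt_extChartAt (mem_chart_source H p)
  have := tangentCoordChange_self (I := I) (x := p) (z := p) (v := v) (mem_extChartAt_source p)
  rw [tangentCoordChange_def] at this
  rw [chartDeriv, h1.mfderiv]
  exact this

variable [I.Boundaryless] [IsManifold I 1 M]

theorem chartSymmDeriv_comp_chartDeriv {y : E} (hy : y ∈ (extChartAt I p).target) :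
    chartSymmDeriv I p y ∘L chartDeriv I p ((extChartAt I p).symm y) =
      ContinuousLinearMap.id ℝ E := by
  have := mfderivWithin_extChartAt_symm_comp_mfderiv_extChartAt (I := I) (x := p) hy
  rw [I.range_eq_univ, mfderivWithin_univ] at this
  exact this

theorem chartSymmDeriv_self :
    chartSymmDeriv I p (extChartAt I p p) = ContinuousLinearMap.id ℝ E := by
  have := chartSymmDeriv_comp_chartDeriv I p (mem_extChartAt_target p)
  rwa [extChartAt_to_inv, chartDeriv_self, ContinuousLinearMap.comp_id] at this

theorem chartDeriv_comp_chartSymmDeriv {y : E} (hy : y ∈ (extChartAt I p).target) :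
    chartDeriv I p ((extChartAt I p).symm y) ∘L chartSymmDeriv I p y =
      ContinuousLinearMap.id ℝ E := by
  have := mfderiv_extChartAt_comp_mfderivWithin_extChartAt_symm (I := I) (x := p) hy
  rw [I.range_eq_univ, mfderivWithin_univ] at this
  exact this

theorem inChart_self (g : FormField M E) : inChart I g p (extChartAt I p p) = g p := by
  ext v w
  rw [inChart, chartSymmDeriv_self, extChartAt_to_inv]
  rfl

variable {I} in
theorem IsMetric.isMetricNear_inChart {g : FormField M E} (hg : IsMetric I g) {y : E}
    (hy : y ∈ (extChartAt I p).target) : IsMetricNear (inChart I g p) y := by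
  have hnhds : (extChartAt I p).target ∈ 𝓝 y := extChartAt_target_mem_nhds' hy
  refine ⟨((hg.smooth p).contDiffAt hnhds).of_le (by norm_cast),
    Eventually.of_forall fun y u v => ?_, ?_⟩
  · simp [inChart, hg.symm _ (chartSymmDeriv I p y u)]
  · filter_upwards [hnhds] with y hy u hu
    have h0 : chartSymmDeriv I p y u = 0 := hg.nondegenerate _ _ fun w => by
      have := hu (chartDeriv I p ((extChartAt I p).symm y) w)
      have h2 := congrArg (fun L => L w) (chartSymmDeriv_comp_chartDeriv I p hy)
      simp only [ContinuousLinearMap.comp_apply, ContinuousLinearMap.id_apply] at h2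
      simpa only [inChart, ContinuousLinearMap.bilinearComp_apply, h2] using this
    have h2 := congrArg (fun L => L u) (chartDeriv_comp_chartSymmDeriv I p hy)
    simpa [h0] using h2.symm

end Charts

section WarpedManifold

variable {E : Type*} [NormedAddCommGroup E] [NormedSpace ℝ E]
  {E' : Type*} [NormedAddCommGroup E'] [NormedSpace ℝ E']
  {H : Type*} [TopologicalSpace H] {I : ModelWithCorners ℝ E' H} [I.Boundaryless]
  {F : Type*} [TopologicalSpace F] [ChartedSpace H F] [IsManifold I ∞ F]
  {η : E →L[ℝ] E →L[ℝ] ℝ} {α : E →L[ℝ] ℝ} {A : E} {φ f : ℝ → ℝ}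

/-- In the product charts, the warped product over a vector space with fibre `F` is the warped
product with fibre the corresponding chart of `F`. -/
theorem inChart_warpedField (gF : FormField F E') (p : E × F) {y : E × E'}
    (hy : y ∈ (extChartAt (𝓘(ℝ, E).prod I) p).target) :
    inChart (𝓘(ℝ, E).prod I) (warpedField η α φ f gF) p y =
      warpedField η α φ f (inChart I gF p.2) y := by
  have hy2 : y.2 ∈ (extChartAt I p.2).target := by
    rw [extChartAt_prod] at hy
    exact hy.2
  have hd : MDifferentiableAt 𝓘(ℝ, E') I (extChartAt I p.2).symm y.2 := by
    have := mdifferentiableWithinAt_extChartAt_symm (I := I) hy2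
    rwa [I.range_eq_univ, mdifferentiableWithinAt_univ] at this
  have hsymm : ((extChartAt (𝓘(ℝ, E).prod I) p).symm : E × E' → E × F) =
      Prod.map id (extChartAt I p.2).symm := by
    rw [extChartAt_prod, extChartAt_model_space_eq_id]
    rfl
  have hderiv : chartSymmDeriv (𝓘(ℝ, E).prod I) p y =
      (ContinuousLinearMap.id ℝ E).prodMap (chartSymmDeriv I p.2 y.2) := by
    rw [chartSymmDeriv, hsymm]
    have h1 : MDifferentiableAt 𝓘(ℝ, E) 𝓘(ℝ, E) (id : E → E) y.1 := mdifferentiableAt_id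
    have := mfderiv_prodMap (p := y) h1 hd
    rw [mfderiv_id] at this
    rw [modelWithCornersSelf_prod, ← chartedSpaceSelf_prod]
    exact this
  refine ContinuousLinearMap.ext fun v => ContinuousLinearMap.ext fun w => ?_
  simp only [inChart, hderiv, hsymm, ContinuousLinearMap.bilinearComp_apply, warpedField_apply,
    Prod.map_fst, Prod.map_snd, id_eq]
  rfl

theorem IsWarpDatum.isMetric_warpedField (hd : IsWarpDatum η α A φ f) {gF : FormField F E'}
    (hF : IsMetric I gF) : IsMetric (𝓘(ℝ, E).prod I) (warpedField η α φ f gF) where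
  symm p v w := by
    rw [warpedField_apply, warpedField_apply, hd.symm, hF.symm]
  nondegenerate p v hv := hd.warpedField_nondegenerate (hF.nondegenerate p.2) hv
  smooth p := by
    refine ContDiffOn.congr (fun y hy => ?_) fun y hy => inChart_warpedField gF p hy
    have hy2 : y.2 ∈ (extChartAt I p.2).target := by
      rw [extChartAt_prod] at hy
      exact hy.2
    exact (hd.contDiffAt_warpedField le_rfl
      ((hF.smooth p.2).contDiffAt (extChartAt_target_mem_nhds' hy2))).contDiffWithinAt

/-- The tensor `Ric + Hess h - ρ g` of a warped product over an Einstein fibre, at the point `p` of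
the manifold, as the same combination of three forms as in coordinates. -/
theorem IsWarpDatum.ricci_add_hessian [FiniteDimensional ℝ E] [FiniteDimensional ℝ E']
    (hd : IsWarpDatum η α A φ f) {gF : FormField F E'} {lam : ℝ} (hF : IsEinstein I gF lam)
    {h : ℝ → ℝ} (hh : ContDiff ℝ ∞ h) (ρ n m κ t : ℝ) (hn : (Module.finrank ℝ E : ℝ) = n)
    (hm : (Module.finrank ℝ E' : ℝ) = m) (hκ : α A = κ) (p : E × F) (ht : α p.1 = t)
    (v w : E × E') :
    ricci (𝓘(ℝ, E).prod I) (warpedField η α φ f gF) p v w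
        + hessian (𝓘(ℝ, E).prod I) (warpedField η α φ f gF) (fun y => h (α y.1)) p v w
        - ρ * warpedField η α φ f gF p v w =
      ((n - 2) * f t * deriv (deriv φ) t + f t * φ t * deriv (deriv h) t
          - m * φ t * deriv (deriv f) t - 2 * m * deriv φ t * deriv f t
          + 2 * f t * deriv φ t * deriv h t) / (f t * φ t) * (α v.1 * α w.1)
        + (κ * (f t * φ t * deriv (deriv φ) t - (n - 1) * f t * deriv φ t ^ 2
            + m * φ t * deriv φ t * deriv f t - f t * φ t * deriv φ t * deriv h t) - ρ * f t)
          / (f t * φ t ^ 2) * η v.1 w.1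
        + (κ * (-(f t * φ t ^ 2 * deriv (deriv f) t) + (n - 2) * f t * φ t * deriv φ t * deriv f t
            - (m - 1) * φ t ^ 2 * deriv f t ^ 2 + f t * φ t ^ 2 * deriv f t * deriv h t)
            - (ρ * f t ^ 2 - lam)) * gF p.2 v.2 w.2 := by
  have : IsManifold I 1 F := .of_le (n := ∞) (by simp)
  have hcenter : extChartAt (𝓘(ℝ, E).prod I) p p = (p.1, extChartAt I p.2 p.2) := by
    rw [extChartAt_prod]
    rfl
  have hG : inChart (𝓘(ℝ, E).prod I) (warpedField η α φ f gF) p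
      =ᶠ[𝓝 (extChartAt (𝓘(ℝ, E).prod I) p p)] warpedField η α φ f (inChart I gF p.2) := by
    filter_upwards [extChartAt_target_mem_nhds (I := 𝓘(ℝ, E).prod I) p] with y hy
    exact inChart_warpedField gF p hy
  have hfun : ((fun y : E × F => h (α y.1)) ∘ (extChartAt (𝓘(ℝ, E).prod I) p).symm) =
      fun y : E × E' => h (α y.1) := by
    rw [extChartAt_prod, extChartAt_model_space_eq_id]
    rfl
  have hK := hF.isMetric.isMetricNear_inChart p.2 (mem_extChartAt_target (I := I) p.2)
  have hlam : ∀ b c, ricciCoord (inChart I gF p.2) (extChartAt I p.2 p.2) b c =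
      lam * inChart I gF p.2 (extChartAt I p.2 p.2) b c := fun b c => by
    have := hF.ricci_eq p.2 b c
    rw [ricci, chartDeriv_self] at this
    rw [inChart_self]
    exact this
  have key := hd.ricciCoord_add_hessianCoord (z := (p.1, extChartAt I p.2 p.2)) hK hh hlam
    ρ n m κ t hn hm hκ ht v w
  rw [inChart_self] at key
  rw [ricci, hessian, chartDeriv_self, ricciCoord_congr hG, hessianCoord_congr hG, hfun, hcenter,
    ← key]
  simp only [warpedField_apply, inChart_self, ContinuousLinearMap.id_apply]

/-- The soliton equation of the warped product as three differential equations, for an arbitrary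
value `κ` of the constant `η(A, A) = α(A)`. -/
theorem IsWarpDatum.isGradientRicciSoliton_iff [FiniteDimensional ℝ E] [FiniteDimensional ℝ E']
    [Nontrivial E'] [Nonempty F] (hdim : 2 ≤ Module.finrank ℝ E) (hα : α ≠ 0)
    (hd : IsWarpDatum η α A φ f) {gF : FormField F E'} {lam : ℝ} (hF : IsEinstein I gF lam)
    {h : ℝ → ℝ} (hh : ContDiff ℝ ∞ h) (ρ n m κ : ℝ) (hn : (Module.finrank ℝ E : ℝ) = n)
    (hm : (Module.finrank ℝ E' : ℝ) = m) (hκ : α A = κ) :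
    IsGradientRicciSoliton (𝓘(ℝ, E).prod I) (warpedField η α φ f gF) (fun p => h (α p.1)) ρ ↔
      ∀ t : ℝ,
        (n - 2) * f t * deriv (deriv φ) t + f t * φ t * deriv (deriv h) t
          - m * φ t * deriv (deriv f) t - 2 * m * deriv φ t * deriv f t
          + 2 * f t * deriv φ t * deriv h t = 0 ∧
        κ * (f t * φ t * deriv (deriv φ) t - (n - 1) * f t * deriv φ t ^ 2
            + m * φ t * deriv φ t * deriv f t - f t * φ t * deriv φ t * deriv h t) = ρ * f t ∧
        κ * (-(f t * φ t ^ 2 * deriv (deriv f) t) + (n - 2) * f t * φ t * deriv φ t * deriv f t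
            - (m - 1) * φ t ^ 2 * deriv f t ^ 2 + f t * φ t ^ 2 * deriv f t * deriv h t) =
          ρ * f t ^ 2 - lam := by
  have hpt : ∀ p : E × F, (∀ v w : E × E',
      ricci (𝓘(ℝ, E).prod I) (warpedField η α φ f gF) p v w
        + hessian (𝓘(ℝ, E).prod I) (warpedField η α φ f gF) (fun y => h (α y.1)) p v w
        = ρ * warpedField η α φ f gF p v w) ↔ _ := fun p => by
    simp only [← sub_eq_zero (b := ρ * _),
      hd.ricci_add_hessian hF hh ρ n m κ _ hn hm hκ p rfl]
    exact forall_combination_eq_zero_iff hdim hα hd.nondegenerate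
      (hF.isMetric.nondegenerate p.2)
  have hφ0 := hd.conformal_ne_zero
  have hf0 : ∀ t, f t ≠ 0 := fun t => (hd.warp_pos t).ne'
  simp only [div_eq_zero_iff, mul_eq_zero, pow_eq_zero_iff, ne_eq, OfNat.ofNat_ne_zero,
    not_false_eq_true, hφ0, hf0, or_self, or_false, sub_eq_zero (b := ρ * _),
    sub_eq_zero (b := ρ * _ - lam)] at hpt
  constructor
  · intro hs t
    obtain ⟨u, hu⟩ : ∃ u, α u ≠ 0 := by
      by_contra! h0
      exact hα (ContinuousLinearMap.ext h0)
    obtain ⟨q⟩ := ‹Nonempty F›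
    have := (hpt ((t / α u) • u, q)).1 (hs.soliton_eq _)
    simpa only [map_smul, smul_eq_mul, div_mul_cancel₀ t hu] using this
  · intro ht
    refine ⟨hd.isMetric_warpedField hF.isMetric, ?_, fun p => (hpt p).2 (ht _)⟩
    exact (hh.comp α.contDiff).contMDiff.comp contMDiff_fst

end WarpedManifold

end SemiRiemannian

open SemiRiemannian in
/-- Gradient Ricci solitons on the warped product `(ℝⁿ, g / φ²) ×_f F`, where `φ`, `f` and the
potential `h` are functions of `ξ = ∑ i, α i * x i`. -/
theorem theorem1p3
    (n m : ℕ) (hn : 3 ≤ n) (hm : 1 ≤ m)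
    (ε : Fin n → ℝ) (hε : ∀ i, ε i = 1 ∨ ε i = -1)
    {F : Type*} [TopologicalSpace F] [Nonempty F] [ChartedSpace (EuclideanSpace ℝ (Fin m)) F]
    [IsManifold (𝓡 m) ∞ F]
    (gF : FormField F (EuclideanSpace ℝ (Fin m))) (lam : ℝ) (hF : IsEinstein (𝓡 m) gF lam)
    (α : Fin n → ℝ) (hα : α ≠ 0)
    (φ f h : ℝ → ℝ) (hφ : ContDiff ℝ ∞ φ) (hf : ContDiff ℝ ∞ f) (hh : ContDiff ℝ ∞ h)
    (hφ0 : ∀ t, φ t ≠ 0) (hf0 : ∀ t, 0 < f t)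
    (ξ : EuclideanSpace ℝ (Fin n) → ℝ) (hξ : ∀ x, ξ x = ∑ i, α i * x i)
    (gt : FormField (EuclideanSpace ℝ (Fin n) × F)
      (EuclideanSpace ℝ (Fin n) × EuclideanSpace ℝ (Fin m)))
    (hgt : gt = warpedProduct (conformal (pseudoEuclidean ε) (fun x => φ (ξ x)))
      (fun x => f (ξ x)) gF)
    (ρ : ℝ) :
    ((∑ i, ε i * α i ^ 2 = 1 ∨ ∑ i, ε i * α i ^ 2 = -1) →
      (IsGradientRicciSoliton ((𝓡 n).prod (𝓡 m)) gt (fun p => h (ξ p.1)) ρ ↔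
        ∀ t : ℝ,
          ((n : ℝ) - 2) * f t * deriv (deriv φ) t + f t * φ t * deriv (deriv h) t
              - m * φ t * deriv (deriv f) t - 2 * m * deriv φ t * deriv f t
              + 2 * f t * deriv φ t * deriv h t = 0 ∧
          ∑ k, ε k * α k ^ 2 *
              (f t * φ t * deriv (deriv φ) t - ((n : ℝ) - 1) * f t * deriv φ t ^ 2
                + m * φ t * deriv φ t * deriv f t - f t * φ t * deriv φ t * deriv h t)
            = ρ * f t ∧
          ∑ k, ε k * α k ^ 2 *
              (-(f t * φ t ^ 2 * deriv (deriv f) t)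
                + ((n : ℝ) - 2) * f t * φ t * deriv φ t * deriv f t
                - ((m : ℝ) - 1) * φ t ^ 2 * deriv f t ^ 2
                + f t * φ t ^ 2 * deriv f t * deriv h t)
            = ρ * f t ^ 2 - lam)) ∧
    (∑ i, ε i * α i ^ 2 = 0 →
      (IsGradientRicciSoliton ((𝓡 n).prod (𝓡 m)) gt (fun p => h (ξ p.1)) ρ ↔
        (∀ t : ℝ,
          ((n : ℝ) - 2) * f t * deriv (deriv φ) t + f t * φ t * deriv (deriv h) t
              - m * φ t * deriv (deriv f) t - 2 * m * deriv φ t * deriv f t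
              + 2 * f t * deriv φ t * deriv h t = 0) ∧
        ρ = 0 ∧ lam = 0)) := by
  have hε2 : ∀ i, ε i * ε i = 1 := fun i => by rcases hε i with h | h <;> simp [h]
  set η := pseudoEuclidean ε 0 with hη
  set αL : EuclideanSpace ℝ (Fin n) →L[ℝ] ℝ :=
    ∑ i, α i • (EuclideanSpace.proj i : EuclideanSpace ℝ (Fin n) →L[ℝ] ℝ) with hαL
  have hαL_apply : ∀ x, αL x = ∑ i, α i * x i := fun x => by
    simp [hαL]
  obtain rfl : ξ = αL := funext fun x => by rw [hξ, hαL_apply]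
  set A : EuclideanSpace ℝ (Fin n) := WithLp.toLp 2 fun i => ε i * α i with hA
  have hd : IsWarpDatum η αL A φ f := by
    refine ⟨fun u v => ?_, fun u hu => ?_, fun v => ?_, hφ, hf, hφ0, hf0⟩
    · simp only [hη, pseudoEuclidean_apply, mul_comm (u _)]
    · ext i
      -- The `i`-th coordinate of `u` is read off by pairing `u` with the `i`-th basis vector.
      have := hu (EuclideanSpace.single i 1)
      rw [hη, pseudoEuclidean_apply, Finset.sum_eq_single i (by simp +contextual) (by simp)] at this
      have hi : ε i ≠ 0 := left_ne_zero_of_mul (hε2 i ▸ one_ne_zero)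
      simpa [hi] using this
    · rw [hη, pseudoEuclidean_apply, hαL_apply]
      refine Finset.sum_congr rfl fun i _ => ?_
      linear_combination α i * v i * hε2 i
  have hκ : αL A = ∑ i, ε i * α i ^ 2 := by
    rw [hαL_apply]
    exact Finset.sum_congr rfl fun i _ => by simp only [hA]; ring
  have hα0 : αL ≠ 0 := by
    intro h0
    refine hα (funext fun i => ?_)
    have := congrArg (fun L => L (EuclideanSpace.single i 1)) h0
    rw [hαL_apply, Finset.sum_eq_single i (by simp +contextual) (by simp)] at this
    simpa using this
  have : Nonempty (Fin m) := ⟨⟨0, hm⟩⟩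
  have hgt' : gt = warpedField η αL φ f gF := hgt
  have key := hd.isGradientRicciSoliton_iff (by simpa using by omega) hα0 hF hh ρ n m _
    (by simp) (by simp) hκ
  rw [hgt']
  simp only [← Finset.sum_mul]
  refine ⟨fun _ => key, fun h0 => key.trans ?_⟩
  simp only [h0, zero_mul]
  constructor
  · intro H
    have hρ : ρ = 0 := by
      simpa [(hf0 0).ne'] using (H 0).2.1.symm
    refine ⟨fun t => (H t).1, hρ, ?_⟩
    simpa [hρ] using (H 0).2.2
  · rintro ⟨H, rfl, rfl⟩ t
    exact ⟨H t, by simp, by simp⟩
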